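/- **Setting.** A pool of $K$ drafters is used for speculative decoding over a finite vocabulary with draft length $N_{\max}$. If drafter $i$ is used in round $t$, its $j$-th drafted token ($j=1,\dots,N_{\max}$) has acceptance rate $\alpha_{i,t,j}=1-d_{TV}(p,q_i)$, where $p$ and $q_i$ are the next-token distributions of the target model and of drafter $i$ at the current context; the token passes its test with this conditional probability, and $N_{acc}(i,t)$ is the number of drafted tokens passed before the first failure. The environment is stationary: the rates of drafter $i$ are i.i.d. with a law $\nu_i$ on $[0,1]$ of mean $\alpha_i$, and different rounds are independent. The reward $r_{i,t}\in[0,1]$ is any random variable of round $t$ with $\mathbb{E}[r_{i,t}]=\mu_i$ for all $t$; within its round it may depend arbitrarily on the rates and on the accepted tokens. Round $t$ with chosen drafter $a_t$ generates $N_{acc}(a_t,t)+1$ tokens. A (possibly randomized) policy $\pi$ chooses $a_t$ from the drafters, rewards and numbers of accepted tokens observed in the earlier rounds; $\tau(\pi,B)$ is the number of rounds until at least $B$ tokens are generated, and $$\mathrm{Reg}(\pi,B)=\mathbb{E}[\tau(\pi,B)]-\inf_{\pi'}\mathbb{E}[\tau(\pi',B)].$$ MetaSD-UCB (exploration parameter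 $\beta=1$) first uses each drafter once; then, as long as fewer than $B$ tokens have been generated, and after $t$ rounds in all, it uses a drafter $i$ maximizing $\hat\mu_i+\sqrt{2\ln t/n_i}$ (ties broken arbitrarily), where $n_i$ is the number of earlier uses of drafter $i$ and $\hat\mu_i$ is the average of their rewards. The $K$ initial rounds are always performed and are counted in $\tau$. **Theorem (generic regret upper bound).** Let $K\ge 2$ and $s_0>1$. There are constants $C',C'''>0$, depending only on $K$ and $s_0$, such that the following holds for every draft length $N_{\max}$, every stationary environment and every reward design as above. Suppose that a drafter $i^\star$ has the largest acceptance rate, $\alpha_{i^\star}=\max_i\alpha_i$, and is the unique drafter with the largest mean reward; put $\Delta_i=\mu_{i^\star}-\mu_i>0$ for $i\neq i^\star$, and suppose that $\sum_{i\ne i^\star}1/\Delta_i^2\ge s_0$ (for $K\ge 3$ this always holds with $s_0=2$). Then for every integer $B\ge 1$ the policy $\pi$ = MetaSD-UCB satisfies $$\mathrm{Reg}(\pi,B)<\sum_{i\neq i^\star}\frac{8}{\Delta_i^2}\Bigl(\ln B+\ln\ln\Bigl(\sum_{k\neq i^\star}\frac1{\Delta_k^2}\Bigr)+C'\Bigr)+C'''.$$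 -/

import Mathlib

open MeasureTheory ProbabilityTheory

noncomputable section

/-- Total variation distance `½ ‖p - q‖₁` of two probability vectors on a finite vocabulary. -/
def tvDist {V : Type*} [Fintype V] (p q : V → ℝ) : ℝ :=
  (∑ x, |p x - q x|) / 2

/-- The random quantities of speculative decoding with a pool of `K` drafters and draft length `N`
over the vocabulary `V`.  Rounds `t` and drafted positions `j` are counted from `0`.
The entries with indices `t i j` describe what happens at the `j`-th drafted token
if drafter `i` is used in round `t`. -/
structure SpecDecoding (K N : ℕ) (V Ω : Type*) where
  /-- next-token distribution of the target model, at the current context -/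
  target : ℕ → Fin K → Fin N → Ω → V → ℝ
  /-- next-token distribution of the drafter, at the current context -/
  drafter : ℕ → Fin K → Fin N → Ω → V → ℝ
  /-- uniform random number that decides whether the drafted token is accepted -/
  coin : ℕ → Fin K → Fin N → Ω → ℝ
  /-- the reward `r_{i,t}` that is fed to the bandit if drafter `i` is used in round `t` -/
  reward : ℕ → Fin K → Ω → ℝ
  /-- private randomness of the bandit policy -/
  seed : Ω → ℝ

namespace SpecDecoding

variable {K N : ℕ} {V Ω : Type*} [Fintype V]

/-- Acceptance rate `1 - d_TV(p, q_i)` of a drafted token. -/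
def rate (D : SpecDecoding K N V Ω) (t : ℕ) (i : Fin K) (j : Fin N) (ω : Ω) : ℝ :=
  1 - tvDist (D.target t i j ω) (D.drafter t i j ω)

open Classical in
/-- `N_acc(i,t)`: the number of drafted tokens accepted before the first rejection, the token at
position `j` passing its test with conditional probability equal to its acceptance rate. -/
def numAccepted (D : SpecDecoding K N V Ω) (t : ℕ) (i : Fin K) (ω : Ω) : ℕ :=
  (Finset.univ.filter fun m : Fin N => ∀ j ≤ m, D.coin t i j ω < D.rate t i j ω).card

/-- Everything that determines rewards and accepted tokens in round `t`. -/
def roundData (D : SpecDecoding K N V Ω) (t : ℕ) (ω : Ω) :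
    (Fin K → Fin N → ℝ) × (Fin K → Fin N → ℝ) × (Fin K → ℝ) :=
  (fun i j => D.rate t i j ω, fun i j => D.coin t i j ω, fun i => D.reward t i ω)

/-- The stationary environment.  For each drafter `i` the acceptance rates are i.i.d. with law
`ν i`, and `r_{i,t}` is any `[0,1]`-valued reward with mean `μ i`.  Different rounds are
independent; inside a round, the reward may depend in any way on the acceptance rates and on the
accepted tokens, and different drafters may depend on each other in any way. -/
structure Stationary [MeasurableSpace Ω] (D : SpecDecoding K N V Ω) (P : Measure Ω)
    (ν : Fin K → Measure ℝ) (μ : Fin K → ℝ) : Prop where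
  target_mem : ∀ t i j ω, D.target t i j ω ∈ stdSimplex ℝ V
  drafter_mem : ∀ t i j ω, D.drafter t i j ω ∈ stdSimplex ℝ V
  measurable_target : ∀ t i j, Measurable (D.target t i j)
  measurable_drafter : ∀ t i j, Measurable (D.drafter t i j)
  measurable_coin : ∀ t i j, Measurable (D.coin t i j)
  measurable_reward : ∀ t i, Measurable (D.reward t i)
  measurable_seed : Measurable D.seed
  /-- `α_{i,t} ∼ ν_i` -/
  rate_law : ∀ t i j, P.map (D.rate t i j) = ν i
  coin_law : ∀ t i j, P.map (D.coin t i j) = volume.restrict (Set.Icc (0 : ℝ) 1)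
  seed_law : P.map D.seed = volume.restrict (Set.Icc (0 : ℝ) 1)
  /-- the acceptance rates and the coins of one drafter in one round are mutually independent -/
  indep_positions : ∀ t i, iIndepFun (Sum.elim (D.rate t i) (D.coin t i)) P
  indep_rounds : iIndepFun D.roundData P
  indep_seed : IndepFun D.seed (fun ω t => D.roundData t ω) P
  reward_mem : ∀ t i ω, D.reward t i ω ∈ Set.Icc (0 : ℝ) 1
  reward_mean : ∀ t i, ∫ ω, D.reward t i ω ∂P = μ i

end SpecDecoding

/-- What a policy sees of a round: the drafter used, its reward, the number of accepted tokens. -/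
abbrev RoundObs (K : ℕ) : Type := Fin K × ℝ × ℕ

/-- A (possibly randomized) bandit policy: from its private seed and the observations of the first
`t` rounds it chooses the drafter of round `t`.  It performs `warmup` rounds before it starts to
test whether enough tokens have been generated (`warmup = 0` for the generic loop). -/
structure BanditPolicy (K : ℕ) where
  warmup : ℕ
  arm : (t : ℕ) → ℝ → (Fin t → RoundObs K) → Fin K
  measurable_arm : ∀ t, Measurable (Function.uncurry (arm t))

namespace SpecDecoding

variable {K N : ℕ} {V Ω : Type*} [Fintype V]

/-- The observations made in the first `t` rounds when `π` selects the drafters. -/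
def history (D : SpecDecoding K N V Ω) (π : BanditPolicy K) (ω : Ω) :
    (t : ℕ) → Fin t → RoundObs K
  | 0 => Fin.elim0
  | t + 1 =>
    let h := D.history π ω t
    let a := π.arm t (D.seed ω) h
    Fin.snoc (α := fun _ => RoundObs K) h (a, D.reward t a ω, D.numAccepted t a ω)

/-- `a_t`: the drafter that `π` uses in round `t`. -/
def action (D : SpecDecoding K N V Ω) (π : BanditPolicy K) (t : ℕ) (ω : Ω) : Fin K :=
  π.arm t (D.seed ω) (D.history π ω t)

/-- `∑_{s < t} (N_acc(a_s, s) + 1)`: the number of tokens generated in the first `t` rounds. -/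
def tokens (D : SpecDecoding K N V Ω) (π : BanditPolicy K) (t : ℕ) (ω : Ω) : ℕ :=
  ∑ s ∈ Finset.range t, (D.numAccepted s (D.action π s ω) ω + 1)

/-- `τ(π, B)`: the total number of rounds performed by `π` for target sequence length `B`.
Every round generates a token, so the set is never empty. -/
def stoppingTime (D : SpecDecoding K N V Ω) (π : BanditPolicy K) (B : ℕ) (ω : Ω) : ℕ :=
  sInf {n | π.warmup ≤ n ∧ B ≤ D.tokens π n ω}

/-- `E[τ(π, B)]` -/
def expectedRounds [MeasurableSpace Ω] (D : SpecDecoding K N V Ω) (P : Measure Ω)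
    (π : BanditPolicy K) (B : ℕ) : ℝ :=
  ∫ ω, (D.stoppingTime π B ω : ℝ) ∂P

/-- The stopping time regret: the excess of `E[τ(π, B)]` over the optimal value of `E[τ(π', B)]`
among all policies `π'`. -/
def regret [MeasurableSpace Ω] (D : SpecDecoding K N V Ω) (P : Measure Ω)
    (π : BanditPolicy K) (B : ℕ) : ℝ :=
  D.expectedRounds P π B - ⨅ π' : BanditPolicy K, D.expectedRounds P π' B

end SpecDecoding

/-- `n_i`: how often drafter `i` was used in the first `t` rounds. -/
def pullCount {K t : ℕ} (h : Fin t → RoundObs K) (i : Fin K) : ℕ :=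
  (Finset.univ.filter fun s => (h s).1 = i).card

/-- Empirical mean reward of drafter `i` over the first `t` rounds. -/
def empiricalMean {K t : ℕ} (h : Fin t → RoundObs K) (i : Fin K) : ℝ :=
  (∑ s ∈ Finset.univ.filter (fun s => (h s).1 = i), (h s).2.1) / pullCount h i

/-- The upper confidence index of drafter `i` after `t` rounds. -/
def ucbIndex {K t : ℕ} (β : ℝ) (h : Fin t → RoundObs K) (i : Fin K) : ℝ :=
  empiricalMean h i + β * Real.sqrt (2 * Real.log t / pullCount h i)

/-- `π` is the MetaSD-UCB algorithm with exploration parameter `β`, for some way of breaking ties: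
it first uses every drafter once, in order, and then, as long as tokens are missing,
a drafter of maximal upper confidence index. -/
structure IsMetaSDUCB {K : ℕ} (β : ℝ) (π : BanditPolicy K) : Prop where
  warmup_eq : π.warmup = K
  arm_init : ∀ (i : Fin K) (u : ℝ) (h : Fin i → RoundObs K), π.arm i u h = i
  arm_max : ∀ t, K ≤ t → ∀ (u : ℝ) (h : Fin t → RoundObs K) (i : Fin K),
    ucbIndex β h i ≤ ucbIndex β h (π.arm t u h)

end

/-! Two independent arguments meet in the bound "regret ≤ warmup + expected number of uses of
drafters other than `istar`".

The bound itself is dynamic programming. The rates and coins of one drafter in one round are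
independent, so N_acc ≥ m has probability α^m for m ≤ N. Only the mean rate matters, and a larger
mean gives stochastically more accepted tokens. Let V(b) be the expected number of rounds that
`istar` alone needs for b tokens (`renewalTime`). A policy chooses before the data of the round are
drawn, so telescoping V over the missing tokens writes the expected number of unfinished rounds, for
every policy, as V(B) plus a sum of Bellman residuals of the chosen drafters (`sum_unfinished_eq`).
As V is nondecreasing, a residual is nonnegative for every drafter, zero for `istar`, and at most 1
otherwise. Hence V(B) is a lower bound for all policies, and exceeding it costs at most one round
per use of another drafter (`regret_le`).

The number of such uses is bounded by the UCB1 argument. Rewards in [0,1] with a fixed mean,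
independent of the past, give a Hoeffding supermartingale (`integral_expDeviation_le`), hence
confidence bounds failing with probability at most t⁻³. While they hold, drafter i is used only if
it has been used fewer than 8 ln t / Δ_i² times. This already yields the sum of 8 ln B / Δ_i² plus a
constant; the constant C' only keeps the additional iterated logarithm from making the bound
smaller. -/

/-! ### Total variation, independence and uniform coins. -/

theorem tvDist_nonneg {V : Type*} [Fintype V] (p q : V → ℝ) : 0 ≤ tvDist p q :=
  div_nonneg (Finset.sum_nonneg fun _ _ => abs_nonneg _) (by norm_num)

theorem tvDist_le_one {V : Type*} [Fintype V] {p q : V → ℝ} (hp : p ∈ stdSimplex ℝ V)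
    (hq : q ∈ stdSimplex ℝ V) : tvDist p q ≤ 1 := by
  have h : ∑ x, |p x - q x| ≤ ∑ x, (p x + q x) := by
    refine Finset.sum_le_sum fun x _ => ?_
    have h1 := hp.1 x
    have h2 := hq.1 x
    rw [abs_le]
    constructor <;> linarith
  rw [Finset.sum_add_distrib, hp.2, hq.2] at h
  unfold tvDist
  linarith

theorem measurable_tvDist {V Ω : Type*} [Fintype V] [MeasurableSpace Ω] {p q : Ω → V → ℝ}
    (hp : Measurable p) (hq : Measurable q) : Measurable fun ω => tvDist (p ω) (q ω) := by
  have hp' : ∀ x, Measurable fun ω => p ω x := fun x => (measurable_pi_apply x).comp hp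
  have hq' : ∀ x, Measurable fun ω => q ω x := fun x => (measurable_pi_apply x).comp hq
  unfold tvDist
  refine Measurable.div_const (Finset.measurable_sum _ fun x _ => ?_) _
  exact ((hp' x).sub (hq' x)).abs

/-- Real random variables measurable with respect to independent σ-algebras are uncorrelated. -/
theorem ProbabilityTheory.Indep.integral_fun_mul {Ω : Type*} {m₁ m₂ m : MeasurableSpace Ω}
    {P : Measure Ω} (h : Indep m₁ m₂ P) (h₁ : m₁ ≤ m) (h₂ : m₂ ≤ m) {f g : Ω → ℝ}
    (hf : Measurable[m₁] f) (hg : Measurable[m₂] g) :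
    ∫ ω, f ω * g ω ∂P = (∫ ω, f ω ∂P) * ∫ ω, g ω ∂P := by
  have hfg : IndepFun f g P := by
    rw [IndepFun_iff_Indep]
    exact indep_of_indep_of_le_left (indep_of_indep_of_le_right h hg.comap_le) hf.comap_le
  exact hfg.integral_fun_mul_eq_mul_integral (hf.mono h₁ le_rfl).aestronglyMeasurable
    (hg.mono h₂ le_rfl).aestronglyMeasurable

/-- The joint law is the product of the three marginals, and products of measures can be
reassociated. It serves to join the policy seed to the earlier rounds. -/
theorem ProbabilityTheory.IndepFun.prodMk_left {Ω α β γ : Type*} [MeasurableSpace Ω]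
    [MeasurableSpace α] [MeasurableSpace β] [MeasurableSpace γ] {P : Measure Ω}
    [IsProbabilityMeasure P] {X : Ω → α} {Y : Ω → β} {Z : Ω → γ} (hX : Measurable X)
    (hY : Measurable Y) (hZ : Measurable Z) (h : IndepFun X (fun ω => (Y ω, Z ω)) P)
    (h' : IndepFun Y Z P) : IndepFun (fun ω => (X ω, Y ω)) Z P := by
  have h₁ : IndepFun X Y P := h.comp measurable_id measurable_fst
  rw [indepFun_iff_map_prod_eq_prod_map_map (by fun_prop) (by fun_prop)] at h h' h₁ ⊢
  have : IsProbabilityMeasure (P.map X) := Measure.isProbabilityMeasure_map hX.aemeasurable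
  have : IsProbabilityMeasure (P.map Y) := Measure.isProbabilityMeasure_map hY.aemeasurable
  have : IsProbabilityMeasure (P.map Z) := Measure.isProbabilityMeasure_map hZ.aemeasurable
  rw [h₁]
  rw [h'] at h
  have e := congrArg (Measure.map MeasurableEquiv.prodAssoc.symm) h
  rw [Measure.map_map (by fun_prop) (by fun_prop), ← Measure.prodAssoc_prod,
    Measure.map_map (by fun_prop) (by fun_prop)] at e
  rw [MeasurableEquiv.symm_comp_self, Measure.map_id] at e
  exact e

/-- A uniform random number in `[0,1]` is below an independent `[0,1]`-valued random variable
with probability the mean of the latter. -/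
theorem measureReal_uniform_lt {Ω : Type*} [MeasurableSpace Ω] {P : Measure Ω}
    [IsProbabilityMeasure P] {U R : Ω → ℝ} (hU : Measurable U) (hR : Measurable R)
    (hUl : P.map U = volume.restrict (Set.Icc (0 : ℝ) 1)) (hR01 : ∀ ω, R ω ∈ Set.Icc (0 : ℝ) 1)
    (h : IndepFun R U P) : P.real {ω | U ω < R ω} = ∫ ω, R ω ∂P := by
  rw [indepFun_iff_map_prod_eq_prod_map_map (by fun_prop) (by fun_prop), hUl] at h
  have hS : MeasurableSet {x : ℝ × ℝ | x.2 < x.1} := measurableSet_lt measurable_snd measurable_fst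
  have e : P {ω | U ω < R ω} = P.map (fun ω => (R ω, U ω)) {x : ℝ × ℝ | x.2 < x.1} := by
    rw [Measure.map_apply (by fun_prop) hS]; rfl
  -- Fubini: for a fixed value r of `R` the slice within the unit interval is [0, r), of length r.
  rw [measureReal_def, e, h, Measure.prod_apply hS, lintegral_map (measurable_measure_prodMk_left hS) hR,
    integral_eq_lintegral_of_nonneg_ae (.of_forall fun ω => (hR01 ω).1) hR.aestronglyMeasurable]
  congr 1
  refine lintegral_congr fun ω => ?_
  have : Prod.mk (R ω) ⁻¹' {x : ℝ × ℝ | x.2 < x.1} = Set.Iio (R ω) := rfl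
  rw [this, Measure.restrict_apply measurableSet_Iio]
  have : Set.Iio (R ω) ∩ Set.Icc 0 1 = Set.Ico 0 (R ω) := by
    ext x
    have := (hR01 ω).2
    simp only [Set.mem_inter_iff, Set.mem_Iio, Set.mem_Icc, Set.mem_Ico]
    constructor
    · rintro ⟨a, b, c⟩; exact ⟨b, a⟩
    · rintro ⟨a, b⟩; exact ⟨b, a, by linarith⟩
  rw [this, Real.volume_Ico, sub_zero]

/-! ### The law of the number of accepted tokens. -/

namespace SpecDecoding

variable {K N : ℕ} {V Ω : Type*} [Fintype V] {D : SpecDecoding K N V Ω}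

/-- The set being counted is an initial segment of `Fin N`, so its cardinality is compared with
those of `Iio m` and `Iic m`. -/
theorem lt_numAccepted_iff (t : ℕ) (i : Fin K) (ω : Ω) (m : Fin N) :
    (m : ℕ) < D.numAccepted t i ω ↔ ∀ j ≤ m, D.coin t i j ω < D.rate t i j ω := by
  classical
  unfold numAccepted
  constructor
  · intro h
    by_contra hm
    have : (Finset.univ.filter fun m : Fin N =>
        ∀ j ≤ m, D.coin t i j ω < D.rate t i j ω) ⊆ Finset.Iio m := by
      intro k hk
      rw [Finset.mem_filter] at hk
      rw [Finset.mem_Iio]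
      by_contra hmk
      exact hm fun j hj => hk.2 j (hj.trans (not_lt.1 hmk))
    have := Finset.card_le_card this
    rw [Fin.card_Iio] at this
    convert absurd h (not_lt.2 _)
    convert this
  · intro h
    have : Finset.Iic m ⊆ (Finset.univ.filter fun m : Fin N =>
        ∀ j ≤ m, D.coin t i j ω < D.rate t i j ω) := by
      intro k hk
      rw [Finset.mem_Iic] at hk
      rw [Finset.mem_filter]
      exact ⟨Finset.mem_univ _, fun j hj => h j (hj.trans hk)⟩
    have := Finset.card_le_card this
    rw [Fin.card_Iic] at this
    refine Nat.lt_of_succ_le ?_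
    convert this

theorem numAccepted_le (t : ℕ) (i : Fin K) (ω : Ω) : D.numAccepted t i ω ≤ N := by
  unfold numAccepted
  exact (Finset.card_le_univ _).trans_eq (Fintype.card_fin N)

/-- Abel summation for a function of the number of accepted tokens. -/
theorem apply_numAccepted (g : ℕ → ℝ) (t : ℕ) (i : Fin K) (ω : Ω) :
    g (D.numAccepted t i ω) = g 0 + ∑ m : Fin N, (g (m + 1) - g m) *
      {ω | ∀ j ≤ m, D.coin t i j ω < D.rate t i j ω}.indicator 1 ω := by
  classical
  have h : ∀ n ≤ N, g n = g 0 + ∑ m : Fin N, (g (m + 1) - g m) * (if (m : ℕ) < n then 1 else 0) := by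
    intro n hn
    rw [Fin.sum_univ_eq_sum_range (fun m => (g (m + 1) - g m) * (if m < n then 1 else 0)) N]
    simp only [mul_ite, mul_one, mul_zero]
    rw [← Finset.sum_filter]
    have : (Finset.range N).filter (· < n) = Finset.range n := by
      ext x; simp only [Finset.mem_filter, Finset.mem_range]; omega
    rw [this, Finset.sum_range_sub]
    ring
  rw [h _ (numAccepted_le t i ω)]
  congr 1
  refine Finset.sum_congr rfl fun m _ => ?_
  congr 1
  simp only [lt_numAccepted_iff, Set.indicator_apply, Set.mem_ofPred_eq, Pi.one_apply]

namespace Stationary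

variable [MeasurableSpace Ω] {P : Measure Ω} {ν : Fin K → Measure ℝ} {μ : Fin K → ℝ}

theorem measurable_rate (h : D.Stationary P ν μ) (t : ℕ) (i : Fin K) (j : Fin N) :
    Measurable (D.rate t i j) :=
  (measurable_tvDist (h.measurable_target t i j) (h.measurable_drafter t i j)).const_sub 1

theorem rate_mem (h : D.Stationary P ν μ) (t : ℕ) (i : Fin K) (j : Fin N) (ω : Ω) :
    D.rate t i j ω ∈ Set.Icc (0 : ℝ) 1 := by
  have h1 := tvDist_nonneg (D.target t i j ω) (D.drafter t i j ω)
  have h2 := tvDist_le_one (h.target_mem t i j ω) (h.drafter_mem t i j ω)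
  unfold rate
  constructor <;> linarith

theorem integral_rate (h : D.Stationary P ν μ) (t : ℕ) (i : Fin K) (j : Fin N) :
    ∫ ω, D.rate t i j ω ∂P = ∫ a, a ∂(ν i) := by
  rw [← h.rate_law t i j, integral_map (h.measurable_rate t i j).aemeasurable]
  exact measurable_id.aestronglyMeasurable

theorem measurableSet_accept_le (h : D.Stationary P ν μ) (t : ℕ) (i : Fin K) (m : Fin N) :
    MeasurableSet {ω | ∀ j ≤ m, D.coin t i j ω < D.rate t i j ω} := by
  have : {ω | ∀ j ≤ m, D.coin t i j ω < D.rate t i j ω} =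
      ⋂ j : Fin N, ⋂ _ : j ≤ m, {ω | D.coin t i j ω < D.rate t i j ω} := by
    ext ω; simp
  rw [this]
  exact MeasurableSet.iInter fun j => MeasurableSet.iInter fun _ =>
    measurableSet_lt (h.measurable_coin t i j) (h.measurable_rate t i j)

theorem integral_law_nonneg (h : D.Stationary P ν μ) (i : Fin K) (m : Fin N) :
    0 ≤ ∫ a, a ∂(ν i) := by
  rw [← h.integral_rate 0 i m]
  exact integral_nonneg fun ω => (h.rate_mem 0 i m ω).1

variable [IsProbabilityMeasure P]

theorem measureReal_accept (h : D.Stationary P ν μ) (t : ℕ) (i : Fin K) (j : Fin N) :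
    P.real {ω | D.coin t i j ω < D.rate t i j ω} = ∫ a, a ∂(ν i) := by
  rw [← h.integral_rate t i j]
  refine measureReal_uniform_lt (h.measurable_coin t i j) (h.measurable_rate t i j)
    (h.coin_law t i j) (h.rate_mem t i j) ?_
  exact (h.indep_positions t i).indepFun (i := Sum.inl j) (j := Sum.inr j) (by simp)

/-- The test at position k involves a rate and a coin disjoint from those of the earlier positions,
so each further test contributes an independent factor equal to the mean rate. -/
theorem measureReal_accept_lt (h : D.Stationary P ν μ) (t : ℕ) (i : Fin K) (k : ℕ) (hk : k ≤ N) :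
    P.real {ω | ∀ j : Fin N, (j : ℕ) < k → D.coin t i j ω < D.rate t i j ω} =
      (∫ a, a ∂(ν i)) ^ k := by
  induction k with
  | zero => simp
  | succ k ih =>
    let m : Fin N ⊕ Fin N → MeasurableSpace Ω := fun x =>
      MeasurableSpace.comap (Sum.elim (D.rate t i) (D.coin t i) x) inferInstance
    let S : Set (Fin N ⊕ Fin N) := {x | (x.elim id id : Fin N).val < k}
    let T : Set (Fin N ⊕ Fin N) := {x | (x.elim id id : Fin N).val = k}
    have hle : ∀ x, m x ≤ ‹MeasurableSpace Ω› := by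
      rintro (j | j)
      · exact (h.measurable_rate t i j).comap_le
      · exact (h.measurable_coin t i j).comap_le
    have hI : Indep (⨆ x ∈ S, m x) (⨆ x ∈ T, m x) P :=
      indep_iSup_of_disjoint hle ((h.indep_positions t i).iIndep)
        (Set.disjoint_left.2 fun x hx hx' => (ne_of_lt hx) hx')
    have key : ∀ (U : Set (Fin N ⊕ Fin N)) (j : Fin N), Sum.inl j ∈ U → Sum.inr j ∈ U →
        MeasurableSet[⨆ x ∈ U, m x] {ω | D.coin t i j ω < D.rate t i j ω} := by
      intro U j h1 h2
      have e1 : Measurable[⨆ x ∈ U, m x] (D.rate t i j) :=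
        measurable_iff_comap_le.2 (le_iSup₂ (f := fun x (_ : x ∈ U) => m x) (Sum.inl j) h1)
      have e2 : Measurable[⨆ x ∈ U, m x] (D.coin t i j) :=
        measurable_iff_comap_le.2 (le_iSup₂ (f := fun x (_ : x ∈ U) => m x) (Sum.inr j) h2)
      exact measurableSet_lt e2 e1
    have hA : MeasurableSet[⨆ x ∈ S, m x]
        {ω | ∀ j : Fin N, (j : ℕ) < k → D.coin t i j ω < D.rate t i j ω} := by
      have : {ω | ∀ j : Fin N, (j : ℕ) < k → D.coin t i j ω < D.rate t i j ω} =
          ⋂ j : Fin N, ⋂ _ : (j : ℕ) < k, {ω | D.coin t i j ω < D.rate t i j ω} := by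
        ext ω; simp
      rw [this]
      exact MeasurableSet.iInter fun j => MeasurableSet.iInter fun hj => key S j hj hj
    have hB := key T ⟨k, hk⟩ rfl rfl
    have e := (Indep_iff _ _ P).1 hI _ _ hA hB
    have e' : {ω | ∀ j : Fin N, (j : ℕ) < k + 1 → D.coin t i j ω < D.rate t i j ω} =
        {ω | ∀ j : Fin N, (j : ℕ) < k → D.coin t i j ω < D.rate t i j ω} ∩
          {ω | D.coin t i ⟨k, hk⟩ ω < D.rate t i ⟨k, hk⟩ ω} := by
      ext ω
      simp only [Set.mem_ofPred_eq, Set.mem_inter_iff]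
      constructor
      · exact fun H => ⟨fun j hj => H j (by omega), H _ (Nat.lt_succ_self k)⟩
      · rintro ⟨H, H'⟩ j hj
        rcases Nat.lt_succ_iff_lt_or_eq.1 hj with hj | rfl
        · exact H j hj
        · exact H'
    rw [measureReal_def, e', e, ENNReal.toReal_mul, ← measureReal_def, ← measureReal_def,
      ih (by omega), h.measureReal_accept, pow_succ]

theorem integral_apply_numAccepted (h : D.Stationary P ν μ) (g : ℕ → ℝ) (t : ℕ) (i : Fin K) :
    ∫ ω, g (D.numAccepted t i ω) ∂P =
      g 0 + ∑ m : Fin N, (g (m + 1) - g m) * (∫ a, a ∂(ν i)) ^ (m + 1 : ℕ) := by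
  have hint : ∀ m : Fin N, Integrable (fun ω => (g (m + 1) - g m) *
      {ω | ∀ j ≤ m, D.coin t i j ω < D.rate t i j ω}.indicator (1 : Ω → ℝ) ω) P := fun m =>
    (((integrable_const (1 : ℝ)).indicator (h.measurableSet_accept_le t i m))).const_mul _
  simp_rw [apply_numAccepted g t i]
  rw [integral_add (integrable_const _) (integrable_finsetSum _ fun m _ => hint m),
    integral_finsetSum _ fun m _ => hint m]
  simp only [integral_const, probReal_univ, smul_eq_mul, one_mul]
  congr 1
  refine Finset.sum_congr rfl fun m _ => ?_
  rw [integral_const_mul, integral_indicator_one (h.measurableSet_accept_le t i m),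
    ← h.measureReal_accept_lt t i (m + 1) m.2]
  congr 3
  ext ω
  simp only [Nat.lt_succ_iff, Fin.le_def]

/-- The drafter with the larger acceptance rate accepts stochastically more tokens. -/
theorem integral_apply_numAccepted_anti (h : D.Stationary P ν μ) {g : ℕ → ℝ} (hg : Antitone g)
    (s t : ℕ) {i k : Fin K} (hik : ∫ a, a ∂(ν i) ≤ ∫ a, a ∂(ν k)) :
    ∫ ω, g (D.numAccepted s k ω) ∂P ≤ ∫ ω, g (D.numAccepted t i ω) ∂P := by
  rw [h.integral_apply_numAccepted, h.integral_apply_numAccepted]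
  refine add_le_add_right (Finset.sum_le_sum fun m _ => ?_) _
  -- After Abel summation, the powers of the mean rate carry the nonpositive increments of `g`.
  refine mul_le_mul_of_nonpos_left ?_ (sub_nonpos.2 (hg (Nat.le_succ m)))
  exact pow_le_pow_left₀ (h.integral_law_nonneg i m) hik _

end Stationary
end SpecDecoding

/-! ### Past and present of a round. -/

namespace SpecDecoding

variable {K N : ℕ} {V Ω : Type*} [Fintype V] {D : SpecDecoding K N V Ω}

/-- The σ-algebra of the policy seed and of the data of the first `t` rounds. -/
@[reducible]
noncomputable def past (D : SpecDecoding K N V Ω) (t : ℕ) : MeasurableSpace Ω :=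
  MeasurableSpace.comap (fun ω => (D.seed ω, fun s : Finset.range t => D.roundData s ω)) inferInstance

/-- The σ-algebra of the data of round `t`. -/
@[reducible]
noncomputable def present (D : SpecDecoding K N V Ω) (t : ℕ) : MeasurableSpace Ω :=
  MeasurableSpace.comap (D.roundData t) inferInstance

theorem measurable_seed_past (t : ℕ) : Measurable[D.past t] D.seed :=
  measurable_fst.comp (comap_measurable
    (fun ω => (D.seed ω, fun s : Finset.range t => D.roundData s ω)))

theorem measurable_roundData_past {s t : ℕ} (hst : s < t) :
    Measurable[D.past t] (D.roundData s) :=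
  (measurable_pi_apply (⟨s, Finset.mem_range.2 hst⟩ : Finset.range t)).comp
    (measurable_snd.comp (comap_measurable
      (fun ω => (D.seed ω, fun s : Finset.range t => D.roundData s ω))))

theorem present_le_past {s t : ℕ} (hst : s < t) : D.present s ≤ D.past t :=
  (measurable_roundData_past hst).comap_le

theorem past_mono {s t : ℕ} (hst : s ≤ t) : D.past s ≤ D.past t := by
  have : Measurable[D.past t] fun ω => fun u : Finset.range s => D.roundData u ω := by
    refine @measurable_pi_lambda _ _ _ (D.past t) _ _ fun u => ?_
    exact measurable_roundData_past ((Finset.mem_range.1 u.2).trans_le hst)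
  exact ((measurable_seed_past t).prodMk this).comap_le

theorem measurable_reward_present (t : ℕ) (i : Fin K) :
    Measurable[D.present t] (D.reward t i) :=
  (measurable_pi_apply i).comp (measurable_snd.comp (measurable_snd.comp
    (comap_measurable (D.roundData t))))

theorem measurable_numAccepted_present (t : ℕ) (i : Fin K) :
    Measurable[D.present t] (D.numAccepted t i) := by
  classical
  have h1 : ∀ j : Fin N, Measurable[D.present t] (D.rate t i j) := fun j =>
    (measurable_pi_apply j).comp ((measurable_pi_apply i).comp (measurable_fst.comp
      (comap_measurable (D.roundData t))))
  have h2 : ∀ j : Fin N, Measurable[D.present t] (D.coin t i j) := fun j =>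
    (measurable_pi_apply j).comp ((measurable_pi_apply i).comp (measurable_fst.comp
      (measurable_snd.comp (comap_measurable (D.roundData t)))))
  have h3 : ∀ m : Fin N, MeasurableSet[D.present t]
      {ω | ∀ j ≤ m, D.coin t i j ω < D.rate t i j ω} := by
    intro m
    have : {ω | ∀ j ≤ m, D.coin t i j ω < D.rate t i j ω} =
        ⋂ j : Fin N, ⋂ _ : j ≤ m, {ω | D.coin t i j ω < D.rate t i j ω} := by
      ext ω; simp
    rw [this]
    exact MeasurableSet.iInter fun j => MeasurableSet.iInter fun _ =>
      measurableSet_lt (h2 j) (h1 j)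
  have e : D.numAccepted t i = fun ω => ∑ m : Fin N,
      if ∀ j ≤ m, D.coin t i j ω < D.rate t i j ω then 1 else 0 := by
    ext ω
    unfold numAccepted
    rw [Finset.card_filter]
  rw [e]
  exact Finset.measurable_sum _ fun m _ =>
    Measurable.ite (h3 m) measurable_const measurable_const

theorem action_eq (π : BanditPolicy K) (t : ℕ) (ω : Ω) :
    D.action π t ω = π.arm t (D.seed ω) (D.history π ω t) := rfl

theorem history_succ (π : BanditPolicy K) (t : ℕ) (ω : Ω) :
    D.history π ω (t + 1) = Fin.snoc (α := fun _ => RoundObs K) (D.history π ω t)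
      (D.action π t ω, D.reward t (D.action π t ω) ω, D.numAccepted t (D.action π t ω) ω) := rfl

theorem history_apply (π : BanditPolicy K) (t : ℕ) (ω : Ω) (s : Fin t) :
    D.history π ω t s =
      (D.action π s ω, D.reward s (D.action π s ω) ω, D.numAccepted s (D.action π s ω) ω) := by
  induction t with
  | zero => exact s.elim0
  | succ t ih =>
    rw [history_succ]
    refine Fin.lastCases ?_ (fun s => ?_) s
    · rw [Fin.snoc_last, Fin.val_last]
    · rw [Fin.snoc_castSucc, ih, Fin.val_castSucc]

/-- Evaluating a finite family of measurable functions at a measurable index. -/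
theorem _root_.Measurable.apply_fin {Ω β : Type*} {m : MeasurableSpace Ω} [MeasurableSpace β]
    {n : ℕ} {f : Fin n → Ω → β} {a : Ω → Fin n} (hf : ∀ i, Measurable[m] (f i))
    (ha : Measurable[m] a) : Measurable[m] fun ω => f (a ω) ω := by
  have : Measurable fun p : Fin n × Ω => f p.1 p.2 := measurable_from_prod_countable_right hf
  exact this.comp (ha.prodMk measurable_id)

theorem measurable_action_of_history {π : BanditPolicy K} {t : ℕ}
    (h : Measurable[D.past t] fun ω => D.history π ω t) : Measurable[D.past t] (D.action π t) :=
  (π.measurable_arm t).comp ((measurable_seed_past t).prodMk h)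

theorem measurable_history (π : BanditPolicy K) (t : ℕ) :
    Measurable[D.past t] fun ω => D.history π ω t := by
  induction t with
  | zero => exact @measurable_pi_lambda _ _ _ (D.past 0) _ _ fun s => s.elim0
  | succ t ih =>
    refine @measurable_pi_lambda _ _ _ (D.past (t + 1)) _ _ fun s => ?_
    simp only [history_succ]
    refine Fin.lastCases ?_ (fun s => ?_) s
    · simp only [Fin.snoc_last]
      have ha : Measurable[D.past (t + 1)] (D.action π t) :=
        (measurable_action_of_history ih).mono (past_mono (Nat.le_succ t)) le_rfl
      refine ha.prodMk (Measurable.prodMk ?_ ?_)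
      · exact Measurable.apply_fin (f := D.reward t) (fun i =>
          (measurable_reward_present t i).mono (present_le_past (Nat.lt_succ_self t)) le_rfl) ha
      · exact Measurable.apply_fin (f := D.numAccepted t) (fun i =>
          (measurable_numAccepted_present t i).mono (present_le_past (Nat.lt_succ_self t)) le_rfl) ha
    · simp only [Fin.snoc_castSucc]
      exact (measurable_pi_apply s).comp (ih.mono (past_mono (Nat.le_succ t)) le_rfl)

/-- The choice for round t uses only the seed and rounds before t. This non-anticipation lets
expectations factor in every later estimate. -/
theorem measurable_action (π : BanditPolicy K) (t : ℕ) : Measurable[D.past t] (D.action π t) :=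
  measurable_action_of_history (measurable_history π t)

theorem measurable_action_lt (π : BanditPolicy K) {s t : ℕ} (hst : s < t) :
    Measurable[D.past t] (D.action π s) :=
  (measurable_action π s).mono (past_mono hst.le) le_rfl

theorem measurable_tokens (π : BanditPolicy K) (t : ℕ) : Measurable[D.past t] (D.tokens π t) := by
  refine Finset.measurable_sum _ fun s hs => ?_
  have hs := Finset.mem_range.1 hs
  refine Measurable.add_const ?_ 1
  exact Measurable.apply_fin (f := D.numAccepted s) (fun i =>
    (measurable_numAccepted_present s i).mono (present_le_past hs) le_rfl)
    (measurable_action_lt π hs)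

namespace Stationary

variable [mΩ : MeasurableSpace Ω] {P : Measure Ω} {ν : Fin K → Measure ℝ} {μ : Fin K → ℝ}

theorem measurable_roundData (h : D.Stationary P ν μ) (t : ℕ) : Measurable (D.roundData t) := by
  refine Measurable.prodMk ?_ (Measurable.prodMk ?_ ?_)
  · exact measurable_pi_lambda _ fun i => measurable_pi_lambda _ fun j => h.measurable_rate t i j
  · exact measurable_pi_lambda _ fun i => measurable_pi_lambda _ fun j => h.measurable_coin t i j
  · exact measurable_pi_lambda _ fun i => h.measurable_reward t i

theorem present_le (h : D.Stationary P ν μ) (t : ℕ) : D.present t ≤ mΩ :=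
  (h.measurable_roundData t).comap_le

theorem past_le (h : D.Stationary P ν μ) (t : ℕ) : D.past t ≤ mΩ :=
  (h.measurable_seed.prodMk (measurable_pi_lambda
    (fun ω (s : Finset.range t) => D.roundData s ω) fun s => h.measurable_roundData s)).comap_le

/-- The seed is independent of all rounds jointly, and the earlier rounds are independent of round
t; `IndepFun.prodMk_left` combines the two. -/
theorem indep_past_present [IsProbabilityMeasure P] (h : D.Stationary P ν μ) (t : ℕ) :
    Indep (D.past t) (D.present t) P := by
  refine (IndepFun_iff_Indep _ _ P).1 (IndepFun.prodMk_left h.measurable_seed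
    (measurable_pi_lambda _ fun s => h.measurable_roundData s) (h.measurable_roundData t) ?_ ?_)
  · refine h.indep_seed.comp (φ := id)
      (ψ := fun f => (fun s : Finset.range t => f s, f t)) measurable_id ?_
    fun_prop
  · have := h.indep_rounds.indepFun_finset (Finset.range t) {t} (by simp) h.measurable_roundData
    refine this.comp (φ := id) (ψ := fun f => f ⟨t, Finset.mem_singleton_self t⟩)
      measurable_id ?_
    fun_prop

/-- A function of the past is uncorrelated with a function of the present round. -/
theorem integral_past_mul_present [IsProbabilityMeasure P] (h : D.Stationary P ν μ) (t : ℕ)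
    {f g : Ω → ℝ} (hf : Measurable[D.past t] f) (hg : Measurable[D.present t] g) :
    ∫ ω, f ω * g ω ∂P = (∫ ω, f ω ∂P) * ∫ ω, g ω ∂P :=
  (h.indep_past_present t).integral_fun_mul (h.past_le t) (h.present_le t) hf hg

theorem integral_indicator_past_mul [IsProbabilityMeasure P] (h : D.Stationary P ν μ) (t : ℕ)
    {A : Set Ω} {g : Ω → ℝ} (hA : MeasurableSet[D.past t] A) (hg : Measurable[D.present t] g) :
    ∫ ω, A.indicator 1 ω * g ω ∂P = P.real A * ∫ ω, g ω ∂P := by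
  have hf : Measurable[D.past t] (A.indicator (1 : Ω → ℝ)) :=
    Measurable.indicator (@measurable_const _ _ _ (D.past t) 1) hA
  rw [h.integral_past_mul_present t hf hg, integral_indicator_one (h.past_le t _ hA)]

end Stationary
end SpecDecoding

/-! ### The value function of a single drafter. -/

section Value

variable {Ω : Type*} [MeasurableSpace Ω]

/-- Expected number of rounds until `b` tokens are generated, if each round generates `X + 1`
tokens, independently of the other rounds. -/
noncomputable def renewalTime (P : Measure Ω) (X : Ω → ℕ) : ℕ → ℝ
  | 0 => 0
  | b + 1 => 1 + ∫ ω, renewalTime P X (b - X ω) ∂P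
termination_by b => b
decreasing_by omega

theorem renewalTime_zero (P : Measure Ω) (X : Ω → ℕ) : renewalTime P X 0 = 0 := by
  rw [renewalTime]

theorem renewalTime_succ (P : Measure Ω) (X : Ω → ℕ) (b : ℕ) :
    renewalTime P X (b + 1) = 1 + ∫ ω, renewalTime P X (b - X ω) ∂P := by
  rw [renewalTime]

theorem integrable_apply_nat_of_le {P : Measure Ω} [IsFiniteMeasure P] {Y : Ω → ℕ}
    (hY : Measurable Y) {b : ℕ} (hb : ∀ ω, Y ω ≤ b) (g : ℕ → ℝ) :
    Integrable (fun ω => g (Y ω)) P := by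
  refine Integrable.of_bound ((measurable_of_countable g).comp hY).aestronglyMeasurable
    (∑ k ∈ Finset.range (b + 1), ‖g k‖) (.of_forall fun ω => ?_)
  exact Finset.single_le_sum (f := fun k => ‖g k‖) (fun k _ => norm_nonneg _)
    (Finset.mem_range.2 (Nat.lt_succ_of_le (hb ω)))

theorem integrable_apply_nat_sub {P : Measure Ω} [IsFiniteMeasure P] {X : Ω → ℕ}
    (hX : Measurable X) (g : ℕ → ℝ) (b : ℕ) : Integrable (fun ω => g (b - X ω)) P :=
  integrable_apply_nat_of_le (Y := fun ω => b - X ω) (b := b)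
    ((measurable_of_countable fun k => b - k).comp hX) (fun _ => Nat.sub_le _ _) g

variable {P : Measure Ω} [IsProbabilityMeasure P] {X : Ω → ℕ}

theorem renewalTime_mono (hX : Measurable X) : Monotone (renewalTime P X) := by
  refine monotone_nat_of_le_succ fun b => ?_
  induction b using Nat.strong_induction_on with
  | _ b ih =>
    cases b with
    | zero => simp [renewalTime_succ, renewalTime_zero]
    | succ b =>
      rw [renewalTime_succ, renewalTime_succ P X (b + 1)]
      refine add_le_add_right (integral_mono (integrable_apply_nat_sub hX _ _)
        (integrable_apply_nat_sub hX _ _) fun ω => ?_) _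
      -- Either the subtraction is a true one and the induction hypothesis applies at b - X, or the
      -- round completes both targets and both values are zero.
      rcases le_or_gt (X ω) b with h | h
      · have := ih (b - X ω) (by omega)
        rwa [← Nat.sub_add_comm h] at this
      · rw [Nat.sub_eq_zero_of_le h.le, Nat.sub_eq_zero_of_le h]

theorem antitone_renewalTime_sub (hX : Measurable X) (b : ℕ) :
    Antitone fun k => renewalTime P X (b - k) :=
  fun _ _ h => renewalTime_mono hX (Nat.sub_le_sub_left h b)

end Value

/-! ### Bellman residuals and the stopping time regret. -/

namespace SpecDecoding

variable {K N : ℕ} {V Ω : Type*} [Fintype V] {D : SpecDecoding K N V Ω}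

theorem tokens_succ (π : BanditPolicy K) (t : ℕ) (ω : Ω) :
    D.tokens π (t + 1) ω = D.tokens π t ω + (D.numAccepted t (D.action π t ω) ω + 1) :=
  Finset.sum_range_succ _ _

theorem strictMono_tokens (π : BanditPolicy K) (ω : Ω) : StrictMono fun t => D.tokens π t ω :=
  strictMono_nat_of_lt_succ fun t => by rw [tokens_succ]; omega

/-- Each round generates a token, so the target is reached within B rounds, and the first such time
equals the number of unfinished times below B. Expected rounds thereby become a finite sum of
probabilities. -/
theorem stoppingTime_eq (π : BanditPolicy K) (B : ℕ) (ω : Ω) :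
    D.stoppingTime π B ω =
      max π.warmup (∑ t ∈ Finset.range B, if D.tokens π t ω < B then 1 else 0) := by
  have hex : ∃ n, B ≤ D.tokens π n ω := ⟨B, (strictMono_tokens π ω).le_apply⟩
  have hn : ∀ t, Nat.find hex ≤ t ↔ B ≤ D.tokens π t ω := fun t =>
    ⟨fun h => (Nat.find_spec hex).trans ((strictMono_tokens π ω).monotone h),
      fun h => Nat.find_min' hex h⟩
  have hB : Nat.find hex ≤ B := Nat.find_min' hex (strictMono_tokens π ω).le_apply
  have h1 : (∑ t ∈ Finset.range B, if D.tokens π t ω < B then 1 else 0) = Nat.find hex := by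
    rw [← Finset.card_filter]
    have : (Finset.range B).filter (fun t => D.tokens π t ω < B) =
        Finset.range (Nat.find hex) := by
      ext t
      have := hn t
      rw [Finset.mem_filter, Finset.mem_range, Finset.mem_range]
      omega
    rw [this, Finset.card_range]
  have h2 : {n | π.warmup ≤ n ∧ B ≤ D.tokens π n ω} = Set.Ici (max π.warmup (Nat.find hex)) := by
    ext n
    rw [Set.mem_Ici, max_le_iff, hn]
    rfl
  rw [h1, stoppingTime, h2, csInf_Ici]

/-- One step of the renewal time of the remaining tokens. -/
theorem step_eq_sum (π : BanditPolicy K) (B t : ℕ) (g : ℕ → ℝ) (ω : Ω) :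
    (if D.tokens π t ω < B then 1 else 0) + g (B - D.tokens π (t + 1) ω)
        - g (B - D.tokens π t ω) =
      ∑ i, ∑ r ∈ Finset.range B, {ω | D.action π t ω = i ∧ B - D.tokens π t ω = r + 1}.indicator 1 ω
        * (1 + g (r - D.numAccepted t i ω) - g (r + 1)) := by
  classical
  -- Only the chosen drafter and r + 1 = number of missing tokens contribute; nothing does once the
  -- target is reached.
  rw [Finset.sum_eq_single (D.action π t ω), tokens_succ]
  · rcases lt_or_ge (D.tokens π t ω) B with h | h
    · rw [Finset.sum_eq_single (B - D.tokens π t ω - 1)]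
      · have hmem : ω ∈ {ω' | D.action π t ω' = D.action π t ω ∧
            B - D.tokens π t ω' = B - D.tokens π t ω - 1 + 1} := ⟨rfl, by omega⟩
        rw [Set.indicator_of_mem hmem, if_pos h]
        have e : B - D.tokens π t ω - 1 + 1 = B - D.tokens π t ω := by omega
        have e' : B - (D.tokens π t ω + (D.numAccepted t (D.action π t ω) ω + 1)) =
          B - D.tokens π t ω - 1 - D.numAccepted t (D.action π t ω) ω := by omega
        rw [e, e', Pi.one_apply, one_mul]
      · intro r _ hr
        rw [Set.indicator_of_notMem, zero_mul]
        rintro ⟨_, hr'⟩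
        omega
      · intro hr
        rw [Finset.mem_range] at hr
        omega
    · rw [if_neg (not_lt.2 h), Nat.sub_eq_zero_of_le h, Nat.sub_eq_zero_of_le (by omega),
        Finset.sum_eq_zero]
      · ring
      · intro r _
        rw [Set.indicator_of_notMem, zero_mul]
        rintro ⟨_, hr'⟩
        omega
  · intro i _ hi
    refine Finset.sum_eq_zero fun r _ => ?_
    rw [Set.indicator_of_notMem, zero_mul]
    exact fun h => hi h.1.symm
  · exact fun h => absurd (Finset.mem_univ _) h

theorem measurableSet_action_remaining (π : BanditPolicy K) (B t : ℕ) (i : Fin K) (r : ℕ) :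
    MeasurableSet[D.past t] {ω | D.action π t ω = i ∧ B - D.tokens π t ω = r} := by
  have h1 : MeasurableSet[D.past t] {ω | D.action π t ω = i} :=
    SpecDecoding.measurable_action π t (measurableSet_singleton i)
  have h2 : MeasurableSet[D.past t] {ω | B - D.tokens π t ω = r} :=
    (measurable_of_countable fun k => B - k).comp (SpecDecoding.measurable_tokens π t)
      (measurableSet_singleton r)
  exact h1.inter h2

theorem cast_stoppingTime (π : BanditPolicy K) (B : ℕ) (ω : Ω) :
    (D.stoppingTime π B ω : ℝ) = max (π.warmup : ℝ)
      (∑ t ∈ Finset.range B, if D.tokens π t ω < B then (1 : ℝ) else 0) := by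
  rw [stoppingTime_eq]
  push_cast
  rfl

namespace Stationary

variable [mΩ : MeasurableSpace Ω] {P : Measure Ω} {ν : Fin K → Measure ℝ} {μ : Fin K → ℝ}

theorem measurable_numAccepted (h : D.Stationary P ν μ) (t : ℕ) (i : Fin K) :
    Measurable (D.numAccepted t i) :=
  (measurable_numAccepted_present t i).mono (h.present_le t) le_rfl

theorem measurable_tokens (h : D.Stationary P ν μ) (π : BanditPolicy K) (t : ℕ) :
    Measurable (D.tokens π t) :=
  (SpecDecoding.measurable_tokens π t).mono (h.past_le t) le_rfl

theorem measurable_action (h : D.Stationary P ν μ) (π : BanditPolicy K) (t : ℕ) :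
    Measurable (D.action π t) :=
  (SpecDecoding.measurable_action π t).mono (h.past_le t) le_rfl

theorem measurable_unfinished (h : D.Stationary P ν μ) (π : BanditPolicy K) (B t : ℕ) :
    MeasurableSet {ω | D.tokens π t ω < B} :=
  measurableSet_lt (h.measurable_tokens π t) measurable_const

variable [IsProbabilityMeasure P]

theorem integrable_unfinished (h : D.Stationary P ν μ) (π : BanditPolicy K) (B t : ℕ) :
    Integrable (fun ω => if D.tokens π t ω < B then (1 : ℝ) else 0) P :=
  ((integrable_const (1 : ℝ)).indicator (h.measurable_unfinished π B t)).congr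
    (.of_forall fun ω => by simp [Set.indicator_apply])

theorem integrable_remaining (h : D.Stationary P ν μ) (π : BanditPolicy K) (B t : ℕ) (g : ℕ → ℝ) :
    Integrable (fun ω => g (B - D.tokens π t ω)) P :=
  integrable_apply_nat_sub (h.measurable_tokens π t) g B

/-- The choice and the number of missing tokens belong to the past, the accepted tokens to the
present, so each term factors. The second factor is the Bellman residual of `g` for drafter i with r
+ 1 tokens missing. -/
theorem integral_step (h : D.Stationary P ν μ) (π : BanditPolicy K) (B t : ℕ) (g : ℕ → ℝ) :
    P.real {ω | D.tokens π t ω < B} + ∫ ω, g (B - D.tokens π (t + 1) ω) ∂P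
        - ∫ ω, g (B - D.tokens π t ω) ∂P =
      ∑ i, ∑ r ∈ Finset.range B,
        P.real {ω | D.action π t ω = i ∧ B - D.tokens π t ω = r + 1}
          * (1 + ∫ ω, g (r - D.numAccepted t i ω) ∂P - g (r + 1)) := by
  have e1 : P.real {ω | D.tokens π t ω < B} =
      ∫ ω, (if D.tokens π t ω < B then (1 : ℝ) else 0) ∂P := by
    rw [← integral_indicator_one (h.measurable_unfinished π B t)]
    simp [Set.indicator_apply]
  have hi : Integrable (fun ω => (if D.tokens π t ω < B then (1 : ℝ) else 0) +
      g (B - D.tokens π (t + 1) ω)) P :=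
    (h.integrable_unfinished π B t).add (h.integrable_remaining π B _ g)
  rw [e1, ← integral_add (h.integrable_unfinished π B t) (h.integrable_remaining π B _ g),
    ← integral_sub hi (h.integrable_remaining π B _ g)]
  simp_rw [step_eq_sum π B t g]
  have hg : ∀ i r, Integrable (fun ω => 1 + g (r - D.numAccepted t i ω) - g (r + 1)) P :=
    fun i r => ((integrable_const 1).add
      (integrable_apply_nat_sub (h.measurable_numAccepted t i) g r)).sub (integrable_const _)
  have hint : ∀ i r, Integrable (fun ω =>
      {ω | D.action π t ω = i ∧ B - D.tokens π t ω = r + 1}.indicator (1 : Ω → ℝ) ω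
        * (1 + g (r - D.numAccepted t i ω) - g (r + 1))) P := by
    intro i r
    refine ((hg i r).indicator (h.past_le t _
      (measurableSet_action_remaining π B t i (r + 1)))).congr (.of_forall fun ω => ?_)
    simp only [Set.indicator_apply, Pi.one_apply, ite_mul, one_mul, zero_mul]
  rw [integral_finsetSum _ fun i _ => integrable_finsetSum _ fun r _ => hint i r]
  refine Finset.sum_congr rfl fun i _ => ?_
  rw [integral_finsetSum _ fun r _ => hint i r]
  refine Finset.sum_congr rfl fun r _ => ?_
  have hA := measurableSet_action_remaining (D := D) π B t i (r + 1)
  have hm : Measurable[D.present t] fun ω => 1 + g (r - D.numAccepted t i ω) - g (r + 1) :=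
    (measurable_of_countable fun k => 1 + g (r - k) - g (r + 1)).comp
      (measurable_numAccepted_present t i)
  rw [h.integral_indicator_past_mul t hA hm]
  congr 1
  have hg' := integrable_apply_nat_sub (h.measurable_numAccepted t i) (P := P) g r
  have hg'' : Integrable (fun ω => 1 + g (r - D.numAccepted t i ω)) P :=
    (integrable_const 1).add hg'
  rw [integral_sub hg'' (integrable_const _), integral_add (integrable_const 1) hg']
  simp

/-- Telescoping of `integral_step`: at time 0 all B tokens are missing, at time B none. With `g` the
value function of `istar` this compares an arbitrary policy with constant use of `istar`. -/
theorem sum_unfinished_eq (h : D.Stationary P ν μ) (π : BanditPolicy K) (B : ℕ) {g : ℕ → ℝ}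
    (hg : g 0 = 0) :
    ∑ t ∈ Finset.range B, P.real {ω | D.tokens π t ω < B} =
      g B + ∑ t ∈ Finset.range B, ∑ i, ∑ r ∈ Finset.range B,
        P.real {ω | D.action π t ω = i ∧ B - D.tokens π t ω = r + 1}
          * (1 + ∫ ω, g (r - D.numAccepted t i ω) ∂P - g (r + 1)) := by
  simp_rw [← h.integral_step π B _ g, add_sub_assoc]
  rw [Finset.sum_add_distrib, Finset.sum_range_sub fun t => ∫ ω, g (B - D.tokens π t ω) ∂P]
  have h0 : ∀ ω, g (B - D.tokens π 0 ω) = g B := fun ω => by simp [tokens]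
  have hB : ∀ ω, g (B - D.tokens π B ω) = 0 := fun ω => by
    rw [Nat.sub_eq_zero_of_le (strictMono_tokens π ω).le_apply, hg]
  simp [h0, hB]

/-- Every residual is nonnegative: the value decreases with the number of accepted tokens, and
`istar` accepts stochastically the most. -/
theorem renewalTime_le (h : D.Stationary P ν μ) (π : BanditPolicy K) (B : ℕ) {istar : Fin K}
    (hmax : ∀ i, ∫ a, a ∂(ν i) ≤ ∫ a, a ∂(ν istar)) :
    renewalTime P (D.numAccepted 0 istar) B ≤
      ∑ t ∈ Finset.range B, P.real {ω | D.tokens π t ω < B} := by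
  have hX := h.measurable_numAccepted 0 istar
  rw [h.sum_unfinished_eq π B (renewalTime_zero P (D.numAccepted 0 istar)), le_add_iff_nonneg_right]
  refine Finset.sum_nonneg fun t _ => Finset.sum_nonneg fun i _ => Finset.sum_nonneg fun r _ =>
    mul_nonneg measureReal_nonneg ?_
  rw [renewalTime_succ]
  have := h.integral_apply_numAccepted_anti (antitone_renewalTime_sub (P := P) hX r) 0 t (hmax i)
  linarith

theorem le_renewalTime_add (h : D.Stationary P ν μ) (π : BanditPolicy K) (B : ℕ) (istar : Fin K) :
    ∑ t ∈ Finset.range B, P.real {ω | D.tokens π t ω < B} ≤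
      renewalTime P (D.numAccepted 0 istar) B +
        ∑ i ∈ Finset.univ.erase istar, ∑ t ∈ Finset.range B, P.real {ω | D.action π t ω = i} := by
  have hX := h.measurable_numAccepted 0 istar
  rw [h.sum_unfinished_eq π B (renewalTime_zero P (D.numAccepted 0 istar)), Finset.sum_comm,
    ← Finset.add_sum_erase _ _ (Finset.mem_univ istar)]
  refine add_le_add_right ?_ _
  -- The value function is built from round 0, but the law of the accepted tokens is the same in all
  -- rounds, so the residual of `istar` vanishes.
  have h0 : ∀ t r, 1 + ∫ ω, renewalTime P (D.numAccepted 0 istar) (r - D.numAccepted t istar ω) ∂P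
      - renewalTime P (D.numAccepted 0 istar) (r + 1) = 0 := by
    intro t r
    rw [renewalTime_succ]
    have e1 := h.integral_apply_numAccepted (fun k => renewalTime P (D.numAccepted 0 istar) (r - k))
      t istar
    have e2 := h.integral_apply_numAccepted (fun k => renewalTime P (D.numAccepted 0 istar) (r - k))
      0 istar
    rw [e1, e2, sub_self]
  simp_rw [h0, mul_zero, Finset.sum_const_zero, zero_add]
  refine Finset.sum_le_sum fun i _ => Finset.sum_le_sum fun t _ => ?_
  have hle : ∀ r, 1 + ∫ ω, renewalTime P (D.numAccepted 0 istar) (r - D.numAccepted t i ω) ∂P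
      - renewalTime P (D.numAccepted 0 istar) (r + 1) ≤ 1 := by
    intro r
    have : ∫ ω, renewalTime P (D.numAccepted 0 istar) (r - D.numAccepted t i ω) ∂P ≤
        ∫ _, renewalTime P (D.numAccepted 0 istar) (r + 1) ∂P :=
      integral_mono (integrable_apply_nat_sub (h.measurable_numAccepted t i) _ _)
        (integrable_const _) fun ω => renewalTime_mono hX (by omega)
    rw [integral_const, probReal_univ, one_smul] at this
    linarith
  -- The events for different r are disjoint parts of the event that drafter i is chosen.
  calc _ ≤ ∑ r ∈ Finset.range B, P.real {ω | D.action π t ω = i ∧ B - D.tokens π t ω = r + 1} :=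
        Finset.sum_le_sum fun r _ => mul_le_of_le_one_right measureReal_nonneg (hle r)
    _ = P.real (⋃ r ∈ Finset.range B, {ω | D.action π t ω = i ∧ B - D.tokens π t ω = r + 1}) := by
        rw [measureReal_biUnion_finset]
        · intro r _ s _ hrs
          refine Set.disjoint_left.2 fun ω h1 h2 => hrs ?_
          have := h1.2.symm.trans h2.2
          omega
        · exact fun r _ => h.past_le t _ (measurableSet_action_remaining π B t i (r + 1))
    _ ≤ _ := by
        refine measureReal_mono ?_
        intro ω hω
        simp only [Set.mem_iUnion] at hω
        obtain ⟨r, _, hr⟩ := hω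
        exact hr.1

theorem integral_sum_unfinished (h : D.Stationary P ν μ) (π : BanditPolicy K) (B : ℕ) :
    ∫ ω, (∑ t ∈ Finset.range B, if D.tokens π t ω < B then (1 : ℝ) else 0) ∂P =
      ∑ t ∈ Finset.range B, P.real {ω | D.tokens π t ω < B} := by
  rw [integral_finsetSum _ fun t _ => h.integrable_unfinished π B t]
  refine Finset.sum_congr rfl fun t _ => ?_
  rw [← integral_indicator_one (h.measurable_unfinished π B t)]
  simp [Set.indicator_apply]

theorem integrable_stoppingTime (h : D.Stationary P ν μ) (π : BanditPolicy K) (B : ℕ) :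
    Integrable (fun ω => (D.stoppingTime π B ω : ℝ)) P := by
  simp_rw [cast_stoppingTime]
  exact (integrable_const _).sup (integrable_finsetSum _ fun t _ => h.integrable_unfinished π B t)

theorem sum_unfinished_le_expectedRounds (h : D.Stationary P ν μ) (π : BanditPolicy K) (B : ℕ) :
    ∑ t ∈ Finset.range B, P.real {ω | D.tokens π t ω < B} ≤ D.expectedRounds P π B := by
  rw [← h.integral_sum_unfinished]
  refine integral_mono (integrable_finsetSum _ fun t _ => h.integrable_unfinished π B t)
    (h.integrable_stoppingTime π B) fun ω => ?_
  simp only [cast_stoppingTime]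
  exact le_max_right _ _

theorem expectedRounds_le (h : D.Stationary P ν μ) (π : BanditPolicy K) (B : ℕ) :
    D.expectedRounds P π B ≤
      π.warmup + ∑ t ∈ Finset.range B, P.real {ω | D.tokens π t ω < B} := by
  have hi := integrable_finsetSum (Finset.range B) fun t _ => h.integrable_unfinished π B t
  have : D.expectedRounds P π B ≤ ∫ ω, ((π.warmup : ℝ) +
      ∑ t ∈ Finset.range B, if D.tokens π t ω < B then (1 : ℝ) else 0) ∂P := by
    refine integral_mono (h.integrable_stoppingTime π B) ((integrable_const _).add hi) fun ω => ?_
    simp only [cast_stoppingTime]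
    have : (0 : ℝ) ≤ ∑ t ∈ Finset.range B, if D.tokens π t ω < B then (1 : ℝ) else 0 :=
      Finset.sum_nonneg fun t _ => by split_ifs <;> norm_num
    exact max_le (by linarith) (by linarith [(Nat.cast_nonneg π.warmup : (0 : ℝ) ≤ π.warmup)])
  rwa [integral_add (integrable_const _) hi, h.integral_sum_unfinished, integral_const,
    probReal_univ, one_smul] at this

/-- The stopping time regret is at most the length of the warmup plus the expected number of uses
of drafters other than a drafter with the largest acceptance rate. -/
theorem regret_le (h : D.Stationary P ν μ) (π : BanditPolicy K) (B : ℕ) {istar : Fin K}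
    (hmax : ∀ i, ∫ a, a ∂(ν i) ≤ ∫ a, a ∂(ν istar)) :
    D.regret P π B ≤ π.warmup + ∑ i ∈ Finset.univ.erase istar, ∑ t ∈ Finset.range B,
      P.real {ω | D.action π t ω = i} := by
  have : Nonempty (BanditPolicy K) := ⟨π⟩
  have h1 : renewalTime P (D.numAccepted 0 istar) B ≤ ⨅ π', D.expectedRounds P π' B :=
    le_ciInf fun π' => (h.renewalTime_le π' B hmax).trans (h.sum_unfinished_le_expectedRounds π' B)
  have h2 := h.expectedRounds_le π B
  have h3 := h.le_renewalTime_add π B istar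
  unfold regret
  linarith

end Stationary
end SpecDecoding

/-! ### Pull counts and concentration of the rewards. -/

namespace SpecDecoding

variable {K N : ℕ} {V Ω : Type*} [Fintype V] {D : SpecDecoding K N V Ω}

/-- The number of uses of drafter `i` in the first `t` rounds. -/
noncomputable def pulls (D : SpecDecoding K N V Ω) (π : BanditPolicy K) (i : Fin K) (t : ℕ) (ω : Ω) :
    ℕ :=
  ∑ s ∈ Finset.range t, if D.action π s ω = i then 1 else 0

/-- The sum of the rewards of drafter `i` in the first `t` rounds, centred at `m`. -/
noncomputable def deviation (D : SpecDecoding K N V Ω) (π : BanditPolicy K) (m : ℝ) (i : Fin K)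
    (t : ℕ) (ω : Ω) : ℝ :=
  ∑ s ∈ Finset.range t, if D.action π s ω = i then D.reward s i ω - m else 0

theorem pulls_le (π : BanditPolicy K) (i : Fin K) (t : ℕ) (ω : Ω) : D.pulls π i t ω ≤ t := by
  refine (Finset.sum_le_card_nsmul _ _ 1 fun s _ => ?_).trans (by simp)
  split_ifs <;> simp

theorem pullCount_history (π : BanditPolicy K) (i : Fin K) (t : ℕ) (ω : Ω) :
    pullCount (D.history π ω t) i = D.pulls π i t ω := by
  unfold pullCount pulls
  rw [Finset.card_filter]
  simp_rw [history_apply]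
  exact Fin.sum_univ_eq_sum_range (fun s => if D.action π s ω = i then 1 else 0) t

theorem empiricalMean_history {π : BanditPolicy K} {i : Fin K} {t : ℕ} {ω : Ω}
    (h : 1 ≤ D.pulls π i t ω) (m : ℝ) :
    empiricalMean (D.history π ω t) i = m + D.deviation π m i t ω / D.pulls π i t ω := by
  have h0 : (D.pulls π i t ω : ℝ) ≠ 0 := by
    have : (1 : ℝ) ≤ D.pulls π i t ω := by exact_mod_cast h
    positivity
  unfold empiricalMean
  rw [pullCount_history, div_eq_iff h0, add_mul, div_mul_cancel₀ _ h0, Finset.sum_filter]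
  simp_rw [history_apply]
  rw [Fin.sum_univ_eq_sum_range (fun s => if D.action π s ω = i then
    D.reward s (D.action π s ω) ω else 0) t]
  unfold pulls deviation
  push_cast
  rw [Finset.mul_sum, ← Finset.sum_add_distrib]
  refine Finset.sum_congr rfl fun s _ => ?_
  split_ifs with hs
  · rw [hs]; ring
  · simp

theorem measurable_pulls (π : BanditPolicy K) (i : Fin K) (t : ℕ) :
    Measurable[D.past t] (D.pulls π i t) := by
  refine Finset.measurable_sum _ fun s hs => ?_
  exact Measurable.ite (measurable_action_lt π (Finset.mem_range.1 hs) (measurableSet_singleton i))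
    measurable_const measurable_const

theorem measurable_deviation (π : BanditPolicy K) (m : ℝ) (i : Fin K) (t : ℕ) :
    Measurable[D.past t] (D.deviation π m i t) := by
  refine Finset.measurable_sum _ fun s hs => ?_
  have hs := Finset.mem_range.1 hs
  exact Measurable.ite (measurable_action_lt π hs (measurableSet_singleton i))
    (((measurable_reward_present s i).mono (present_le_past hs) le_rfl).sub_const m)
    measurable_const

/-- Each counted round raises the pull count, and none is counted once it has reached x. The
induction needs the sharper bound by the minimum with the pull count. -/
theorem sum_few_pulls_le (π : BanditPolicy K) (i : Fin K) {x : ℝ} (hx : 0 ≤ x) (t : ℕ) (ω : Ω) :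
    ∑ s ∈ Finset.range t, {ω | D.action π s ω = i ∧ (D.pulls π i s ω : ℝ) < x}.indicator 1 ω
      ≤ x + 1 := by
  classical
  suffices h : ∑ s ∈ Finset.range t,
      {ω | D.action π s ω = i ∧ (D.pulls π i s ω : ℝ) < x}.indicator 1 ω ≤
        min (D.pulls π i t ω : ℝ) (x + 1) from h.trans (min_le_right _ _)
  induction t with
  | zero => simp only [Finset.range_zero, Finset.sum_empty]; positivity
  | succ t ih =>
    have ih1 := ih.trans (min_le_left _ _)
    have ih2 := ih.trans (min_le_right _ _)
    have hp : (D.pulls π i (t + 1) ω : ℝ) =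
        D.pulls π i t ω + if D.action π t ω = i then 1 else 0 := by
      unfold pulls
      rw [Finset.sum_range_succ]
      push_cast
      rfl
    rw [Finset.sum_range_succ, hp, Set.indicator_apply]
    simp only [Set.mem_ofPred_eq, Pi.one_apply]
    refine le_min ?_ ?_
    · by_cases h : D.action π t ω = i
      · rw [if_pos h]
        have : (if D.action π t ω = i ∧ (D.pulls π i t ω : ℝ) < x then (1 : ℝ) else 0) ≤ 1 := by
          split_ifs <;> norm_num
        linarith
      · rw [if_neg h, if_neg fun h' => h h'.1]
        linarith
    · split_ifs with h
      · linarith [h.2]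
      · linarith

/-- The exponential process of the deviation of the rewards of drafter `i`. -/
noncomputable def expDeviation (D : SpecDecoding K N V Ω) (π : BanditPolicy K) (m l : ℝ) (i : Fin K)
    (t : ℕ) (ω : Ω) : ℝ :=
  Real.exp (l * D.deviation π m i t ω - l ^ 2 / 8 * D.pulls π i t ω)

theorem measurable_expDeviation (π : BanditPolicy K) (m l : ℝ) (i : Fin K) (t : ℕ) :
    Measurable[D.past t] (D.expDeviation π m l i t) := by
  refine Real.measurable_exp.comp (Measurable.sub ?_ ?_)
  · exact (measurable_deviation π m i t).const_mul l
  · exact ((measurable_of_countable (fun n : ℕ => (n : ℝ))).comp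
      (measurable_pulls π i t)).const_mul _

theorem expDeviation_succ (π : BanditPolicy K) (m l : ℝ) (i : Fin K) (t : ℕ) (ω : Ω) :
    D.expDeviation π m l i (t + 1) ω =
      {ω | D.action π t ω = i}.indicator (D.expDeviation π m l i t) ω *
          Real.exp (l * (D.reward t i ω - m) - l ^ 2 / 8)
        + {ω | D.action π t ω ≠ i}.indicator (D.expDeviation π m l i t) ω := by
  classical
  unfold expDeviation deviation pulls
  rw [Finset.sum_range_succ, Finset.sum_range_succ]
  by_cases h : D.action π t ω = i
  · simp only [Set.indicator_apply, Set.mem_ofPred_eq, h, if_true, ne_eq, not_true, if_false,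
      add_zero]
    rw [← Real.exp_add]
    congr 1
    push_cast
    ring
  · simp [h]

namespace Stationary

variable [mΩ : MeasurableSpace Ω] {P : Measure Ω} {ν : Fin K → Measure ℝ} {μ : Fin K → ℝ}

variable [IsProbabilityMeasure P]

theorem integrable_reward (h : D.Stationary P ν μ) (t : ℕ) (i : Fin K) :
    Integrable (D.reward t i) P :=
  Integrable.of_mem_Icc 0 1 (h.measurable_reward t i).aemeasurable (.of_forall (h.reward_mem t i))

theorem mean_mem (h : D.Stationary P ν μ) (i : Fin K) : μ i ∈ Set.Icc (0 : ℝ) 1 := by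
  rw [← h.reward_mean 0 i]
  refine ⟨integral_nonneg fun ω => (h.reward_mem 0 i ω).1, ?_⟩
  have := integral_mono (h.integrable_reward 0 i) (integrable_const 1)
    fun ω => (h.reward_mem 0 i ω).2
  simpa using this

theorem exp_reward_le (h : D.Stationary P ν μ) (l : ℝ) (t : ℕ) (i : Fin K) (ω : Ω) :
    Real.exp (l * (D.reward t i ω - μ i) - l ^ 2 / 8) ≤ Real.exp |l| := by
  have h1 := h.reward_mem t i ω
  have h2 := h.mean_mem i
  have h3 : |D.reward t i ω - μ i| ≤ 1 := by
    rw [abs_le]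
    constructor <;> linarith [h1.1, h1.2, h2.1, h2.2]
  refine Real.exp_le_exp.2 ?_
  have h4 : l * (D.reward t i ω - μ i) ≤ |l| * 1 := by
    refine (le_abs_self _).trans ?_
    rw [abs_mul]
    exact mul_le_mul_of_nonneg_left h3 (abs_nonneg l)
  nlinarith [sq_nonneg l]

/-- Hoeffding's lemma: an interval of length 1 gives variance proxy 1/4, hence the exponent l²/8. -/
theorem integral_exp_reward_le (h : D.Stationary P ν μ) (l : ℝ) (t : ℕ) (i : Fin K) :
    ∫ ω, Real.exp (l * (D.reward t i ω - μ i) - l ^ 2 / 8) ∂P ≤ 1 := by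
  have := (hasSubgaussianMGF_of_mem_Icc (μ := P) (h.measurable_reward t i).aemeasurable
    (.of_forall (h.reward_mem t i))).mgf_le l
  rw [h.reward_mean t i] at this
  unfold mgf at this
  simp_rw [Real.exp_sub, div_eq_mul_inv]
  rw [integral_mul_const, ← div_eq_mul_inv, div_le_one (Real.exp_pos _)]
  refine this.trans_eq ?_
  congr 1
  norm_num
  ring

theorem integrable_expDeviation (h : D.Stationary P ν μ) (π : BanditPolicy K) (l : ℝ) (i : Fin K)
    (t : ℕ) : Integrable (D.expDeviation π (μ i) l i t) P := by
  refine Integrable.of_bound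
    ((measurable_expDeviation π (μ i) l i t).mono (h.past_le t) le_rfl).aestronglyMeasurable
    (Real.exp |l| ^ t) (.of_forall fun ω => ?_)
  rw [expDeviation, Real.norm_of_nonneg (Real.exp_pos _).le, ← expDeviation]
  induction t with
  | zero => simp [expDeviation, deviation, pulls]
  | succ t ih =>
    have h0 : 0 ≤ D.expDeviation π (μ i) l i t ω := (Real.exp_pos _).le
    have h1 : (1 : ℝ) ≤ Real.exp |l| := Real.one_le_exp (abs_nonneg l)
    rw [pow_succ, expDeviation_succ]
    by_cases ha : D.action π t ω = i
    · simp only [Set.indicator_apply, Set.mem_ofPred_eq, ha, if_true, ne_eq, not_true, if_false,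
        add_zero]
      exact mul_le_mul ih (h.exp_reward_le l t i ω) (Real.exp_pos _).le (by positivity)
    · simp only [Set.indicator_apply, Set.mem_ofPred_eq, ha, if_true, ne_eq, not_false_iff,
        if_false, zero_mul, zero_add]
      nlinarith

/-- The process is a supermartingale. A round using drafter i multiplies it by a factor independent
of the past and of mean at most 1; any other round leaves it unchanged. -/
theorem integral_expDeviation_le (h : D.Stationary P ν μ) (π : BanditPolicy K) (l : ℝ) (i : Fin K)
    (t : ℕ) : ∫ ω, D.expDeviation π (μ i) l i t ω ∂P ≤ 1 := by
  induction t with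
  | zero => simp [expDeviation, deviation, pulls]
  | succ t ih =>
    refine le_trans ?_ ih
    have hZ := h.integrable_expDeviation π l i t
    have hA : MeasurableSet[D.past t] {ω | D.action π t ω = i} :=
      SpecDecoding.measurable_action π t (measurableSet_singleton i)
    have hA' := h.past_le t _ hA
    have hf : Measurable[D.past t]
        ({ω | D.action π t ω = i}.indicator (D.expDeviation π (μ i) l i t)) :=
      Measurable.indicator (measurable_expDeviation π (μ i) l i t) hA
    have hg : Measurable[D.present t]
        fun ω => Real.exp (l * (D.reward t i ω - μ i) - l ^ 2 / 8) :=
      Real.measurable_exp.comp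
        ((((measurable_reward_present t i).sub_const _).const_mul l).sub_const _)
    have hnn : 0 ≤ ∫ ω, {ω | D.action π t ω = i}.indicator (D.expDeviation π (μ i) l i t) ω ∂P :=
      integral_nonneg fun ω => Set.indicator_nonneg (fun ω _ => (Real.exp_pos _).le) ω
    have hfg : Integrable (fun ω => {ω | D.action π t ω = i}.indicator
        (D.expDeviation π (μ i) l i t) ω * Real.exp (l * (D.reward t i ω - μ i) - l ^ 2 / 8)) P := by
      refine (hZ.indicator hA').mul_bdd (c := Real.exp |l|)
        (hg.mono (h.present_le t) le_rfl).aestronglyMeasurable (.of_forall fun ω => ?_)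
      rw [Real.norm_of_nonneg (Real.exp_pos _).le]
      exact h.exp_reward_le l t i ω
    have hc : {ω | D.action π t ω ≠ i} = {ω | D.action π t ω = i}ᶜ := rfl
    simp_rw [expDeviation_succ, hc]
    rw [integral_add hfg (hZ.indicator hA'.compl), h.integral_past_mul_present t hf hg]
    refine (add_le_add_left (mul_le_of_le_one_right hnn (h.integral_exp_reward_le l t i)) _).trans ?_
    rw [← integral_add (hZ.indicator hA') (hZ.indicator hA'.compl)]
    simp_rw [Set.indicator_self_add_compl_apply]
    exact le_rfl

/-- Chernoff bound for the rewards of a drafter that has been used `n` times. -/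
theorem measureReal_chernoff (h : D.Stationary P ν μ) (π : BanditPolicy K) (l y : ℝ) (i : Fin K)
    (t n : ℕ) :
    P.real {ω | D.pulls π i t ω = n ∧ y ≤ l * D.deviation π (μ i) i t ω - l ^ 2 / 8 * n} ≤
      Real.exp (-y) := by
  have h1 := mul_meas_ge_le_integral_of_nonneg
    (.of_forall fun ω => (Real.exp_pos _).le) (h.integrable_expDeviation π l i t) (Real.exp y)
  have h2 := h1.trans (h.integral_expDeviation_le π l i t)
  have h3 : P.real {ω | D.pulls π i t ω = n ∧ y ≤ l * D.deviation π (μ i) i t ω - l ^ 2 / 8 * n} ≤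
      P.real {ω | Real.exp y ≤ D.expDeviation π (μ i) l i t ω} := by
    refine measureReal_mono fun ω hω => ?_
    have : Real.exp y ≤ Real.exp (l * D.deviation π (μ i) i t ω - l ^ 2 / 8 * D.pulls π i t ω) := by
      rw [hω.1]
      exact Real.exp_le_exp.2 hω.2
    exact this
  rw [Real.exp_neg, ← one_div, le_div_iff₀ (Real.exp_pos y)]
  calc _ ≤ _ := mul_le_mul_of_nonneg_right h3 (Real.exp_pos y).le
    _ ≤ 1 := by rw [mul_comm]; exact h2

/-- The confidence bound of a drafter fails after `t` rounds with probability at most `t⁻³`;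
`e = 1` concerns the upper and `e = -1` the lower deviation. -/
theorem measureReal_confidence_fails (h : D.Stationary P ν μ) (π : BanditPolicy K) (i : Fin K)
    {t : ℕ} (ht : 1 ≤ t) {e : ℝ} (he : e ^ 2 = 1) :
    P.real {ω | 1 ≤ D.pulls π i t ω ∧ D.pulls π i t ω * √(2 * Real.log t / D.pulls π i t ω) ≤
      e * D.deviation π (μ i) i t ω} ≤ 1 / (t : ℝ) ^ 3 := by
  have ht' : (0 : ℝ) < t := by exact_mod_cast ht
  have hlog : 0 ≤ Real.log t := Real.log_nonneg (by exact_mod_cast ht)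
  -- The pull count is random, so a union bound runs over its values n ≤ t. With c² n = 2 ln t, the
  -- choice l = 4ce makes the linear term at least 8 ln t and the quadratic one 4 ln t. Each n costs
  -- t⁻⁴, in all t⁻³.
  have hsub : {ω | 1 ≤ D.pulls π i t ω ∧ D.pulls π i t ω * √(2 * Real.log t / D.pulls π i t ω) ≤
      e * D.deviation π (μ i) i t ω} ⊆ ⋃ n ∈ Finset.Icc 1 t, {ω | D.pulls π i t ω = n ∧
        4 * Real.log t ≤ (4 * √(2 * Real.log t / n) * e) * D.deviation π (μ i) i t ω
          - (4 * √(2 * Real.log t / n) * e) ^ 2 / 8 * n} := by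
    intro ω hω
    simp only [Set.mem_iUnion]
    refine ⟨D.pulls π i t ω, Finset.mem_Icc.2 ⟨hω.1, pulls_le π i t ω⟩, rfl, ?_⟩
    have hn : (0 : ℝ) < D.pulls π i t ω := by exact_mod_cast hω.1
    have h2 := hω.2
    generalize (D.pulls π i t ω : ℝ) = n at hn h2 ⊢
    have hc : √(2 * Real.log t / n) ^ 2 * n = 2 * Real.log t := by
      rw [Real.sq_sqrt (by positivity)]
      field_simp
    have hc0 := Real.sqrt_nonneg (2 * Real.log t / n)
    generalize √(2 * Real.log t / n) = c at hc hc0 h2 ⊢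
    have h3 := mul_le_mul_of_nonneg_left h2 hc0
    have h4 : (4 * c * e) ^ 2 / 8 * n = 2 * (c ^ 2 * n) * e ^ 2 := by ring
    rw [h4, he, hc]
    nlinarith
  calc _ ≤ _ := measureReal_mono hsub (measure_ne_top P _)
    _ ≤ ∑ n ∈ Finset.Icc 1 t, Real.exp (-(4 * Real.log t)) :=
        (measureReal_biUnion_finset_le _ _).trans
          (Finset.sum_le_sum fun n _ => h.measureReal_chernoff π _ _ i t n)
    _ = 1 / (t : ℝ) ^ 3 := by
        rw [Finset.sum_const, Nat.card_Icc, Nat.add_sub_cancel, nsmul_eq_mul, Real.exp_neg,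
          mul_comm 4, Real.exp_mul, Real.exp_log ht']
        norm_cast
        field_simp
        norm_cast
        ring

end Stationary
end SpecDecoding

/-! ### Number of uses of the inferior drafters under MetaSD-UCB. -/

namespace SpecDecoding

variable {K N : ℕ} {V Ω : Type*} [Fintype V] {D : SpecDecoding K N V Ω}

theorem one_le_pulls {β : ℝ} {π : BanditPolicy K} (hπ : IsMetaSDUCB β π) (i : Fin K) {t : ℕ}
    (ht : K ≤ t) (ω : Ω) : 1 ≤ D.pulls π i t ω := by
  have h : D.action π i ω = i := hπ.arm_init i _ _
  unfold pulls
  refine le_trans ?_ (Finset.single_le_sum (f := fun s => if D.action π s ω = i then 1 else 0)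
    (fun s _ => Nat.zero_le _) (Finset.mem_range.2 (i.2.trans_le ht)))
  simp [h]

/-- After the warmup, MetaSD-UCB uses a drafter of smaller mean reward only if one of the two
confidence bounds fails or the drafter has been used rarely. -/
theorem action_eq_imp {π : BanditPolicy K} (hπ : IsMetaSDUCB 1 π) {μ : Fin K → ℝ} {i istar : Fin K}
    (hi : μ i < μ istar) {t : ℕ} (ht : K ≤ t) {ω : Ω} (ha : D.action π t ω = i) :
    D.pulls π i t ω * √(2 * Real.log t / D.pulls π i t ω) ≤ 1 * D.deviation π (μ i) i t ω ∨
    D.pulls π istar t ω * √(2 * Real.log t / D.pulls π istar t ω) ≤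
      (-1) * D.deviation π (μ istar) istar t ω ∨
    (D.pulls π i t ω : ℝ) < 8 * Real.log t / (μ istar - μ i) ^ 2 := by
  have h1 := one_le_pulls (D := D) hπ i ht ω
  have h2 := one_le_pulls (D := D) hπ istar ht ω
  have hmax := hπ.arm_max t ht (D.seed ω) (D.history π ω t) istar
  rw [← action_eq, ha] at hmax
  unfold ucbIndex at hmax
  rw [pullCount_history, pullCount_history, empiricalMean_history h1 (μ i),
    empiricalMean_history h2 (μ istar)] at hmax
  have h1' : (0 : ℝ) < D.pulls π i t ω := by exact_mod_cast h1
  have h2' : (0 : ℝ) < D.pulls π istar t ω := by exact_mod_cast h2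
  have hlog : 0 ≤ Real.log t := Real.log_natCast_nonneg t
  by_contra hcon
  simp only [not_or, not_le, not_lt] at hcon
  obtain ⟨c1, c2, c3⟩ := hcon
  generalize (D.pulls π i t ω : ℝ) = n at *
  generalize (D.pulls π istar t ω : ℝ) = m at *
  have d1 : D.deviation π (μ i) i t ω / n < √(2 * Real.log t / n) := by
    rw [div_lt_iff₀ h1']; linarith
  have d2 : -√(2 * Real.log t / m) < D.deviation π (μ istar) istar t ω / m := by
    rw [lt_div_iff₀ h2']; linarith
  have hΔ : 0 < μ istar - μ i := sub_pos.2 hi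
  -- The index of `istar` exceeds its mean and that of i is below `μ i` plus twice its radius, yet i
  -- has the maximal index.
  have d3 : μ istar - μ i < 2 * √(2 * Real.log t / n) := by linarith
  have d4 : (μ istar - μ i) ^ 2 < (2 * √(2 * Real.log t / n)) ^ 2 :=
    pow_lt_pow_left₀ d3 hΔ.le two_ne_zero
  rw [mul_pow, Real.sq_sqrt (by positivity)] at d4
  rw [div_le_iff₀ (by positivity)] at c3
  have d5 : (μ istar - μ i) ^ 2 * n < 8 * Real.log t := by
    have := mul_lt_mul_of_pos_right d4 h1'
    have e : 2 ^ 2 * (2 * Real.log t / n) * n = 8 * Real.log t := by field_simp; ring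
    rwa [e] at this
  linarith

namespace Stationary

variable [mΩ : MeasurableSpace Ω] {P : Measure Ω} {ν : Fin K → Measure ℝ} {μ : Fin K → ℝ}

variable [IsProbabilityMeasure P]

/-- The trivial bound 1 covers the warmup; later the two confidence failures cost t⁻³ each.
Replacing ln t by ln B makes the threshold constant in t, as `sum_few_pulls_le` requires. -/
theorem measureReal_action_le (h : D.Stationary P ν μ) {π : BanditPolicy K} (hπ : IsMetaSDUCB 1 π)
    {i istar : Fin K} (hi : μ i < μ istar) {B t : ℕ} (ht : t < B) :
    P.real {ω | D.action π t ω = i} ≤ (if t < K then 1 else 0) + 2 * (1 / (t : ℝ) ^ 3) +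
      P.real {ω | D.action π t ω = i ∧
        (D.pulls π i t ω : ℝ) < 8 * Real.log B / (μ istar - μ i) ^ 2} := by
  rcases lt_or_ge t K with htK | htK
  · rw [if_pos htK]
    have h1 : P.real {ω | D.action π t ω = i} ≤ 1 := measureReal_le_one
    have h2 : 0 ≤ 2 * (1 / (t : ℝ) ^ 3) := by positivity
    have h3 : 0 ≤ P.real {ω | D.action π t ω = i ∧
        (D.pulls π i t ω : ℝ) < 8 * Real.log B / (μ istar - μ i) ^ 2} := measureReal_nonneg
    linarith
  · have ht1 : 1 ≤ t := (Nat.one_le_iff_ne_zero.2 (Nat.ne_of_gt (i.pos))).trans htK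
    have hlog : Real.log t ≤ Real.log B :=
      Real.log_le_log (by exact_mod_cast ht1) (by exact_mod_cast ht.le)
    have e1 := h.measureReal_confidence_fails π i ht1 (e := 1) (by norm_num)
    have e2 := h.measureReal_confidence_fails π istar ht1 (e := -1) (by norm_num)
    have hsub : {ω | D.action π t ω = i} ⊆
        ({ω | 1 ≤ D.pulls π i t ω ∧ D.pulls π i t ω * √(2 * Real.log t / D.pulls π i t ω) ≤
            1 * D.deviation π (μ i) i t ω} ∪
          {ω | 1 ≤ D.pulls π istar t ω ∧
            D.pulls π istar t ω * √(2 * Real.log t / D.pulls π istar t ω) ≤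
              (-1) * D.deviation π (μ istar) istar t ω}) ∪
          {ω | D.action π t ω = i ∧
            (D.pulls π i t ω : ℝ) < 8 * Real.log B / (μ istar - μ i) ^ 2} := by
      intro ω hω
      rcases action_eq_imp hπ hi htK hω with h1 | h1 | h1
      · exact Or.inl (Or.inl ⟨one_le_pulls hπ i htK ω, h1⟩)
      · exact Or.inl (Or.inr ⟨one_le_pulls hπ istar htK ω, h1⟩)
      · refine Or.inr ⟨hω, h1.trans_le ?_⟩
        gcongr
    rw [if_neg (not_lt.2 htK)]
    refine (measureReal_mono hsub (measure_ne_top P _)).trans ?_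
    refine (measureReal_union_le _ _).trans (add_le_add_left ?_ _)
    refine (measureReal_union_le _ _).trans ?_
    linarith

/-- MetaSD-UCB uses a drafter of smaller mean reward logarithmically often. -/
theorem sum_measureReal_action_le (h : D.Stationary P ν μ) {π : BanditPolicy K}
    (hπ : IsMetaSDUCB 1 π) {i istar : Fin K} (hi : μ i < μ istar) (B : ℕ) :
    ∑ t ∈ Finset.range B, P.real {ω | D.action π t ω = i} ≤
      8 / (μ istar - μ i) ^ 2 * Real.log B + (K + 1 + 2 * ∑' t : ℕ, 1 / (t : ℝ) ^ 3) := by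
  set x := 8 * Real.log B / (μ istar - μ i) ^ 2 with hx
  have hx0 : 0 ≤ x := by
    have : 0 ≤ Real.log B := Real.log_natCast_nonneg B
    positivity
  have h1 := Finset.sum_le_sum fun t (ht : t ∈ Finset.range B) =>
    h.measureReal_action_le hπ hi (Finset.mem_range.1 ht)
  rw [Finset.sum_add_distrib, Finset.sum_add_distrib, ← Finset.mul_sum] at h1
  have h2 : (∑ t ∈ Finset.range B, if t < K then (1 : ℝ) else 0) ≤ K := by
    rw [← Finset.sum_filter, Finset.sum_const, nsmul_eq_mul, mul_one]
    have : (Finset.range B).filter (· < K) ⊆ Finset.range K := fun t ht =>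
      Finset.mem_range.2 (Finset.mem_filter.1 ht).2
    exact_mod_cast (Finset.card_le_card this).trans_eq (Finset.card_range K)
  have h3 : ∑ t ∈ Finset.range B, 1 / (t : ℝ) ^ 3 ≤ ∑' t : ℕ, 1 / (t : ℝ) ^ 3 :=
    (Real.summable_one_div_nat_pow.2 (by norm_num)).sum_le_tsum _ fun t _ => by positivity
  have hm : ∀ t, MeasurableSet {ω | D.action π t ω = i ∧ (D.pulls π i t ω : ℝ) < x} := by
    intro t
    refine (h.measurable_action π t (measurableSet_singleton i)).inter ?_
    exact ((measurable_pulls π i t).mono (h.past_le t) le_rfl)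
      (MeasurableSet.of_discrete (s := {n : ℕ | (n : ℝ) < x}))
  have h4 : ∑ t ∈ Finset.range B,
      P.real {ω | D.action π t ω = i ∧ (D.pulls π i t ω : ℝ) < x} ≤ x + 1 := by
    have hint : ∀ t, Integrable
        ({ω | D.action π t ω = i ∧ (D.pulls π i t ω : ℝ) < x}.indicator (1 : Ω → ℝ)) P := fun t =>
      (integrable_const (1 : ℝ)).indicator (hm t)
    simp_rw [← integral_indicator_one (hm _)]
    rw [← integral_finsetSum _ fun t _ => hint t]
    refine (integral_mono (integrable_finsetSum _ fun t _ => hint t) (integrable_const (x + 1))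
      fun ω => sum_few_pulls_le π i hx0 B ω).trans_eq ?_
    simp
  have e : 8 / (μ istar - μ i) ^ 2 * Real.log B = x := by rw [hx]; ring
  rw [e]
  linarith

end Stationary
end SpecDecoding

/-! ### The regret bound. -/

theorem mainTheorem4 (K : ℕ) (s₀ : ℝ) (hs₀ : 1 < s₀) :
    ∃ C' C''' : ℝ, 0 < C' ∧ 0 < C''' ∧
      ∀ (N : ℕ) (V : Type*) [Fintype V] (Ω : Type*) [MeasurableSpace Ω]
        (P : Measure Ω) [IsProbabilityMeasure P]
        (D : SpecDecoding K N V Ω) (ν : Fin K → Measure ℝ) (μ : Fin K → ℝ),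
        D.Stationary P ν μ →
        ∀ istar : Fin K,
          (∀ i, ∫ a, a ∂(ν i) ≤ ∫ a, a ∂(ν istar)) →
          (∀ i, i ≠ istar → μ i < μ istar) →
          s₀ ≤ ∑ i ∈ Finset.univ.erase istar, 1 / (μ istar - μ i) ^ 2 →
          ∀ π : BanditPolicy K, IsMetaSDUCB 1 π →
            ∀ B : ℕ, 1 ≤ B →
              D.regret P π B <
                (∑ i ∈ Finset.univ.erase istar, 8 / (μ istar - μ i) ^ 2 *
                  (Real.log B
                    + Real.log (Real.log
                        (∑ k ∈ Finset.univ.erase istar, 1 / (μ istar - μ k) ^ 2))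
                    + C'))
                + C''' := by
  have hS : 0 ≤ ∑' t : ℕ, 1 / (t : ℝ) ^ 3 := tsum_nonneg fun t => by positivity
  -- C' outweighs the iterated logarithm where it is negative. C''' collects the warmup K, the
  -- additive constant of each of at most K drafters, and 1 for strictness.
  refine ⟨|Real.log (Real.log s₀)| + 1, K + K * (K + 1 + 2 * ∑' t : ℕ, 1 / (t : ℝ) ^ 3) + 1,
    by positivity, by positivity, ?_⟩
  intro N V _ Ω _ P _ D ν μ h istar hmax hμ hs π hπ B _
  set L := Real.log (Real.log (∑ k ∈ Finset.univ.erase istar, 1 / (μ istar - μ k) ^ 2))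
  set S := ∑' t : ℕ, 1 / (t : ℝ) ^ 3
  have hL : 0 ≤ L + (|Real.log (Real.log s₀)| + 1) := by
    -- Here `s₀` > 1 keeps the inner logarithm positive and bounded away from 0.
    have : Real.log (Real.log s₀) ≤ L := Real.log_le_log (Real.log_pos hs₀)
      (Real.log_le_log (by linarith) hs)
    linarith [neg_abs_le (Real.log (Real.log s₀))]
  have h1 := h.regret_le π B hmax
  rw [hπ.warmup_eq] at h1
  have h2 : ∑ i ∈ Finset.univ.erase istar, ∑ t ∈ Finset.range B, P.real {ω | D.action π t ω = i} ≤
      ∑ i ∈ Finset.univ.erase istar, (8 / (μ istar - μ i) ^ 2 *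
        (Real.log B + L + (|Real.log (Real.log s₀)| + 1)) + (K + 1 + 2 * S)) := by
    refine Finset.sum_le_sum fun i hi => ?_
    refine (h.sum_measureReal_action_le hπ (hμ i (Finset.ne_of_mem_erase hi)) B).trans ?_
    gcongr
    linarith
  rw [Finset.sum_add_distrib] at h2
  have h3 : ∑ _i ∈ Finset.univ.erase istar, ((K : ℝ) + 1 + 2 * S) ≤ K * (K + 1 + 2 * S) := by
    rw [Finset.sum_const, nsmul_eq_mul]
    have : (Finset.univ.erase istar).card ≤ K :=
      (Finset.card_erase_le).trans_eq (Finset.card_fin K)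
    gcongr
  linarith
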